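/- Let $p$ be a prime, $n\in\mathbb{N}$, and let $R=\mathbb{F}_p[x,x^{-1}]$ be the ring of Laurent polynomials. Let $\mathcal{A}_n=\bigoplus_{\mathbb{Z}}(\mathbb{Z}/p\mathbb{Z})^n$, identified with the additive group of $R^n$, so that multiplication by $x$ is the shift by one, and let $\mathcal{L}_n=(\mathbb{Z}/p\mathbb{Z})^n\wr\mathbb{Z}=\mathcal{A}_n\rtimes\mathbb{Z}$, with multiplication $(v,s)(w,t)=(v+x^sw,\,s+t)$. For a subgroup $V\le\mathcal{L}_n$, a triple of $V$ is $(s,V_0,v)$, where $s\ge 0$ is the integer such that $s\mathbb{Z}$ is the image of $V$ under the projection to $\mathbb{Z}$, $V_0=V\cap\mathcal{A}_n$, and $v\in\mathcal{A}_n$ is such that $(v,s)\in V$. Then $x^sV_0=V_0$, so $V_0$ is a submodule of $\mathcal{A}_n^s$, the group $\mathcal{A}_n$ regarded as an $R$-module with $x$ acting by $w\mapsto x^sw$. A subgroup of a group $G$ is called weakly maximal if it has infinite index in $G$, but every subgroup of $G$ properly containing it has finite index. The pro-$p$ topology on $G$ is the topology induced by the natural map from $G$ to its pro-$p$ completion $\varprojlim_N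 G/N$, where $N$ runs through the normal subgroups of $G$ whose index is a power of $p$ and the quotients $G/N$ are discrete. Let $V$ be a subgroup of $\mathcal{L}_n$ and let $(s,V_0,v)$ be its triple. Then $V$ is weakly maximal if and only if either $s=0$ and $V_0=\mathcal{A}_n$, or $s>0$ and $\mathcal{A}_n^s/V_0$ is isomorphic to $R$ as an $R$-module. Moreover, a weakly maximal subgroup $V$ of $\mathcal{L}_n$ with triple $(s,V_0,v)$ is closed in the pro-$p$ topology of $\mathcal{L}_n$ if and only if $s=0$ or $s=p^k$ for some integer $k\ge 0$. -/

import Mathlib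

open scoped LaurentPolynomial Topology

noncomputable section

namespace Lamplighter

/-- The base group `𝒜ₙ = ⨁_ℤ (ℤ/p)ⁿ`, identified with the additive group of `Rⁿ`, where
`R = 𝔽_p[x, x⁻¹] = 𝔽_p[ℤ]` is the ring of Laurent polynomials: the coefficients at `xᵏ` of the `n`
coordinates form the entry in `(ℤ/p)ⁿ` at place `k`. Multiplication by `x` is the shift by one. -/
abbrev Base (p n : ℕ) : Type := Fin n → (ZMod p)[T;T⁻¹]

/-- The action of `ℤ` on the base group: `k` acts as multiplication by `xᵏ`, the shift by `k`. -/
def shift (p n : ℕ) : Multiplicative ℤ →* MulAut (Multiplicative (Base p n)) where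
  toFun k :=
    { toFun := fun a => Multiplicative.ofAdd
        ((LaurentPolynomial.T k.toAdd : (ZMod p)[T;T⁻¹]) • a.toAdd)
      invFun := fun a => Multiplicative.ofAdd
        ((LaurentPolynomial.T (-k.toAdd) : (ZMod p)[T;T⁻¹]) • a.toAdd)
      left_inv := fun a => by
        beta_reduce
        rw [toAdd_ofAdd, smul_smul, ← LaurentPolynomial.T_add, neg_add_cancel,
          LaurentPolynomial.T_zero, one_smul, ofAdd_toAdd]
      right_inv := fun a => by
        beta_reduce
        rw [toAdd_ofAdd, smul_smul, ← LaurentPolynomial.T_add, add_neg_cancel,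
          LaurentPolynomial.T_zero, one_smul, ofAdd_toAdd]
      map_mul' := fun a b => by rw [toAdd_mul, smul_add, ofAdd_add] }
  map_one' := by
    apply MulEquiv.ext
    intro a
    change Multiplicative.ofAdd ((LaurentPolynomial.T 0 : (ZMod p)[T;T⁻¹]) • a.toAdd) = a
    rw [LaurentPolynomial.T_zero, one_smul, ofAdd_toAdd]
  map_mul' k l := by
    apply MulEquiv.ext
    intro a
    change Multiplicative.ofAdd ((LaurentPolynomial.T (k.toAdd + l.toAdd) : (ZMod p)[T;T⁻¹]) •
      a.toAdd) = Multiplicative.ofAdd ((LaurentPolynomial.T k.toAdd : (ZMod p)[T;T⁻¹]) •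
        (LaurentPolynomial.T l.toAdd : (ZMod p)[T;T⁻¹]) • a.toAdd)
    rw [smul_smul, ← LaurentPolynomial.T_add]

/-- The lamplighter group `ℒₙ = (ℤ/p)ⁿ ≀ ℤ = 𝒜ₙ ⋊ ℤ`, with `(v, s)(w, t) = (v + xˢ w, s + t)`. -/
abbrev LGroup (p n : ℕ) : Type :=
  Multiplicative (Base p n) ⋊[shift p n] Multiplicative ℤ

/-- The element `(v, s)` of `ℒₙ`. -/
def elt {p n : ℕ} (v : Base p n) (s : ℤ) : LGroup p n :=
  ⟨Multiplicative.ofAdd v, Multiplicative.ofAdd s⟩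

/-- `(s, V₀, v)` is a triple of the subgroup `V` of `ℒₙ`: the projection of `V` to `ℤ` is `sℤ`, the
intersection of `V` with the base group is `V₀`, and `(v, s) ∈ V`. -/
structure IsTriple {p n : ℕ} (V : Subgroup (LGroup p n)) (s : ℕ) (V₀ : AddSubgroup (Base p n))
    (v : Base p n) : Prop where
  map_proj : V.map SemidirectProduct.rightHom = Subgroup.zpowers (Multiplicative.ofAdd (s : ℤ))
  mem_base : ∀ a : Base p n, a ∈ V₀ ↔ elt a 0 ∈ V
  mem : elt v s ∈ V

/-- The endomorphism `f(x) ↦ f(xˢ)` of the ring of Laurent polynomials. -/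
def expand (p s : ℕ) : (ZMod p)[T;T⁻¹] →+* (ZMod p)[T;T⁻¹] :=
  AddMonoidAlgebra.mapDomainRingHom (ZMod p) (AddMonoidHom.mulLeft (s : ℤ))

/-- `𝒜ₙˢ`: the base group with the structure of an `R`-module in which `x` acts as `v ↦ xˢ v`, so
that `f ∈ R` acts as `v ↦ f(xˢ) v`. -/
def BaseTwist (p n _s : ℕ) : Type := Base p n

instance (p n s : ℕ) : AddCommGroup (BaseTwist p n s) :=
  inferInstanceAs (AddCommGroup (Base p n))

instance (p n s : ℕ) : Module (ZMod p)[T;T⁻¹] (BaseTwist p n s) :=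
  Module.compHom (Base p n) (expand p s)

theorem twist_smul_def {p n s : ℕ} (f : (ZMod p)[T;T⁻¹]) (a : BaseTwist p n s) :
    f • a = (show BaseTwist p n s from expand p s f • (show Base p n from a)) := rfl

theorem expand_C_mul_T (p s : ℕ) (c : ZMod p) (k : ℤ) :
    expand p s (LaurentPolynomial.C c * LaurentPolynomial.T k) =
      LaurentPolynomial.C c * LaurentPolynomial.T (s * k) := by
  rw [← LaurentPolynomial.single_eq_C_mul_T, ← LaurentPolynomial.single_eq_C_mul_T]
  exact AddMonoidAlgebra.mapDomain_single

/-- Every subgroup of `ℒₙ` has a triple. -/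
theorem exists_isTriple {p n : ℕ} (V : Subgroup (LGroup p n)) :
    ∃ s V₀ v, IsTriple V s V₀ v := by
  obtain ⟨g, hg⟩ := (Subgroup.isCyclic_iff_exists_zpowers_eq_top (V.map SemidirectProduct.rightHom)).1
    inferInstance
  obtain ⟨s, hs⟩ : ∃ s : ℕ, V.map SemidirectProduct.rightHom =
      Subgroup.zpowers (Multiplicative.ofAdd (s : ℤ)) := by
    rcases Int.natAbs_eq g.toAdd with h | h
    · exact ⟨g.toAdd.natAbs, by rw [← h, ← hg]; rfl⟩
    · refine ⟨g.toAdd.natAbs, ?_⟩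
      rw [← Subgroup.zpowers_inv, ← ofAdd_neg, ← h, ← hg]; rfl
  have hm : Multiplicative.ofAdd (s : ℤ) ∈ V.map SemidirectProduct.rightHom := by
    rw [hs]; exact Subgroup.mem_zpowers _
  obtain ⟨x, hx, hxs⟩ := hm
  refine ⟨s, Subgroup.toAddSubgroup' (V.comap SemidirectProduct.inl), x.left.toAdd, hs,
    fun a => Iff.rfl, ?_⟩
  have : elt x.left.toAdd (s : ℤ) = x := SemidirectProduct.ext rfl hxs.symm
  rwa [this]

/-- The subgroup `V₀` of a triple `(s, V₀, v)` is invariant under multiplication by `x^{±s}`. -/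
theorem IsTriple.T_smul_mem {p n : ℕ} {V : Subgroup (LGroup p n)} {s : ℕ}
    {V₀ : AddSubgroup (Base p n)} {v : Base p n} (h : IsTriple V s V₀ v) (k : ℤ) {a : Base p n}
    (ha : a ∈ V₀) : (LaurentPolynomial.T (s * k) : (ZMod p)[T;T⁻¹]) • a ∈ V₀ := by
  rw [h.mem_base] at ha ⊢
  have key : elt v s ^ k * elt a 0 * (elt v s ^ k)⁻¹ =
      elt ((LaurentPolynomial.T (s * k) : (ZMod p)[T;T⁻¹]) • a) 0 := by
    have hr : (elt v s ^ k).right = Multiplicative.ofAdd ((s : ℤ) * k) := by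
      have := map_zpow (SemidirectProduct.rightHom (φ := shift p n)) (elt v s) k
      rw [SemidirectProduct.rightHom_eq_right] at this
      rw [this, mul_comm, ← smul_eq_mul, ofAdd_zsmul]
      rfl
    generalize elt v s ^ k = y at hr
    obtain ⟨y1, y2⟩ := y
    subst hr
    apply SemidirectProduct.ext
    · change Multiplicative.ofAdd (y1.toAdd +
          (LaurentPolynomial.T (s * k) : (ZMod p)[T;T⁻¹]) • a) *
        (shift p n (Multiplicative.ofAdd ((s : ℤ) * k) * 1))
          (shift p n (Multiplicative.ofAdd ((s : ℤ) * k))⁻¹ y1⁻¹) = _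
      rw [mul_one, map_inv (shift p n), MulAut.apply_inv_self, ofAdd_add, ofAdd_toAdd, mul_inv_cancel_comm]
      rfl
    · simp [elt]
  rw [← key]
  exact V.mul_mem (V.mul_mem (V.zpow_mem h.mem k) ha) (V.inv_mem (V.zpow_mem h.mem k))

/-- The subgroup `V₀` of a triple `(s, V₀, v)`, as an `R`-submodule of `𝒜ₙˢ`. -/
def IsTriple.submodule {p n : ℕ} {V : Subgroup (LGroup p n)} {s : ℕ}
    {V₀ : AddSubgroup (Base p n)} {v : Base p n} (h : IsTriple V s V₀ v) :
    Submodule (ZMod p)[T;T⁻¹] (BaseTwist p n s) where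
  carrier := {a | (show Base p n from a) ∈ V₀}
  add_mem' := fun ha hb => V₀.add_mem ha hb
  zero_mem' := V₀.zero_mem
  smul_mem' := fun f a ha => by
    induction f using LaurentPolynomial.induction_on' with
    | add f g hf hg => rw [add_smul]; exact V₀.add_mem hf hg
    | C_mul_T k c =>
      change expand p s _ • (show Base p n from a) ∈ V₀
      rw [expand_C_mul_T, mul_smul, LaurentPolynomial.C_eq_algebraMap, algebraMap_smul]
      exact ZMod.smul_mem (K := V₀) (h.T_smul_mem k ha) c

end Lamplighter

/-- A subgroup is weakly maximal if it has infinite index, but every subgroup that properly contains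
it has finite index. -/
def IsWeaklyMaximal {G : Type*} [Group G] (H : Subgroup G) : Prop :=
  ¬ H.FiniteIndex ∧ ∀ K : Subgroup G, H < K → K.FiniteIndex

/-- The normal subgroups of `G` whose index is a power of `p`. -/
def PIndexNormal (p : ℕ) (G : Type*) [Group G] : Type _ :=
  {N : Subgroup G // N.Normal ∧ ∃ k : ℕ, N.index = p ^ k}

/-- The pro-`p` completion of `G`: the inverse limit of the quotients `G ⧸ N`, where `N` runs through
the normal subgroups of `p`-power index. -/
def ProPCompletion (p : ℕ) (G : Type*) [Group G] : Type _ :=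
  {f : (N : PIndexNormal p G) → G ⧸ N.1 //
    ∀ (N M : PIndexNormal p G) (h : N.1 ≤ M.1), Subgroup.quotientMapOfLE h (f N) = f M}

/-- The topology of the inverse limit of discrete spaces. -/
instance (p : ℕ) (G : Type*) [Group G] : TopologicalSpace (ProPCompletion p G) :=
  TopologicalSpace.induced Subtype.val (@Pi.topologicalSpace _ _ fun _ => ⊥)

/-- The natural map from `G` to its pro-`p` completion. -/
def toProPCompletion (p : ℕ) (G : Type*) [Group G] (g : G) : ProPCompletion p G :=
  ⟨fun _ => QuotientGroup.mk g, fun _ _ _ => rfl⟩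

/-- The pro-`p` topology on `G`, induced from the pro-`p` completion. -/
abbrev proPTopology (p : ℕ) (G : Type*) [Group G] : TopologicalSpace G :=
  TopologicalSpace.induced (toProPCompletion p G) inferInstance

end

/-! A subgroup has finite index iff s > 0 and V₀ has finite index in the base group, since it
consists of the products of elements of V₀ with powers of (v, s). For s > 0, the submodules of M =
𝒜ₙˢ / V₀ give the overgroups of V that keep s and v. The ring R is an infinite PID with finite
proper quotients, and M is finitely generated, so an infinite M all of whose proper quotients are
finite must be R (`Module.nonempty_linearEquiv_self_of_finite_quotients`).

Conversely, let φ : 𝒜ₙ → R be the quotient map, and let K > V project to tℤ, with s = tm. If K meets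
the base group in more than V₀, then φ of that intersection contains a nonzero ideal, so K has
finite index. Otherwise V₀ is invariant under xᵗ, which then acts on R as multiplication by some u
with uᵐ = x; degrees force m = 1 (`eq_one_of_ker_invariant`) and K = V, a contradiction.

For s = pᵏ, the subgroups (x^{pᵏ} - 1)ᵉ 𝒜ₙ ⋊ p^{k+i}ℤ with e ≤ pⁱ separate V from its complement,
because the powers of (x - 1) in R intersect in zero. If s = pᵏm with p ∤ m and V is closed, then m
is invertible modulo every power of p, so V₀ is invariant under x^{pᵏ}, and the same argument about
powers gives m = 1. -/

open scoped LaurentPolynomial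

noncomputable section

/-! ### Ring theory of Laurent polynomials over a field -/

namespace LaurentPolynomial

variable {K : Type*} [Field K]

instance : IsDomain K[T;T⁻¹] :=
  IsLocalization.isDomain_of_le_nonZeroDivisors _
    (powers_le_nonZeroDivisors_of_noZeroDivisors (Polynomial.X_ne_zero (R := K)))

/-- In a localization of `K[X]` every ideal is extended from its contraction, which is principal. -/
instance : IsPrincipalIdealRing K[T;T⁻¹] :=
  ⟨fun I => by
    rw [← IsLocalization.map_under (.powers (Polynomial.X : Polynomial K)) K[T;T⁻¹] I]
    exact inferInstance⟩

instance (S : Type*) [Semiring S] [Nontrivial S] : Infinite S[T;T⁻¹] :=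
  Infinite.of_injective (fun k : ℤ => (T k : S[T;T⁻¹])) fun a b h => by
    have := congrArg degree h
    rw [degree_T, degree_T] at this
    exact_mod_cast this

/-- The Laurent polynomial `x` is not a proper power. -/
theorem eq_one_of_pow_eq_T {u : K[T;T⁻¹]} {m : ℕ} (h : u ^ m = T 1) : m = 1 := by
  obtain ⟨a, f, hf⟩ := exists_T_pow u
  -- Clearing denominators gives m ∣ 1 + am on comparing degrees.
  have h1 : f ^ m = Polynomial.X ^ (1 + a * m) := by
    apply Polynomial.toLaurent_injective
    rw [map_pow, hf, mul_pow, h, T_pow, ← T_add, Polynomial.toLaurent_X_pow]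
    push_cast
    ring_nf
  have h2 := congrArg Polynomial.natDegree h1
  rw [Polynomial.natDegree_pow, Polynomial.natDegree_X_pow] at h2
  have : m ∣ 1 := (Nat.dvd_add_left (Dvd.intro_left a rfl)).1 (Dvd.intro _ h2)
  exact Nat.dvd_one.1 this

/-- A nonzero ideal contains a nonzero polynomial f, and the finite ring `K[X]/(f)` maps onto the
quotient: two powers of x agree there, so x⁻¹ is itself a nonnegative power of x. -/
instance [Finite K] : Ring.HasFiniteQuotients K[T;T⁻¹] where
  finiteQuotient := by
    intro I hI
    obtain ⟨u, hu, hu0⟩ := Submodule.exists_mem_ne_zero_of_ne_bot hI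
    obtain ⟨a, f, hf⟩ := exists_T_pow u
    have hf0 : f ≠ 0 := by
      rintro rfl
      rw [map_zero] at hf
      exact hu0 ((isUnit_T (R := K) a).mul_left_eq_zero.1 hf.symm)
    have hfI : Polynomial.toLaurent f ∈ I := hf ▸ I.mul_mem_right _ hu
    have : Module.Finite K (AdjoinRoot f) := (AdjoinRoot.powerBasis hf0).finite
    have : Finite (AdjoinRoot f) := Module.finite_of_finite K
    let ψ : Polynomial K →+* K[T;T⁻¹] ⧸ I :=
      (Ideal.Quotient.mk I).comp (Polynomial.toLaurent)
    have hker : ∀ g ∈ Ideal.span {f}, ψ g = 0 := fun g hg => by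
      obtain ⟨c, rfl⟩ := Ideal.mem_span_singleton.1 hg
      exact Ideal.Quotient.eq_zero_iff_mem.2 (by rw [map_mul]; exact I.mul_mem_right _ hfI)
    let χ : AdjoinRoot f →+* K[T;T⁻¹] ⧸ I := Ideal.Quotient.lift _ ψ hker
    have hχ : ∀ g, ψ g ∈ Set.range χ := fun g => ⟨AdjoinRoot.mk f g, rfl⟩
    have hfin : (Set.range χ).Finite := Set.finite_range χ
    have : Finite (Set.range χ) := hfin
    obtain ⟨b, c, hbc, h⟩ := Finite.exists_ne_map_eq_of_infinite
      (fun k : ℕ => (⟨ψ (Polynomial.X ^ k), hχ _⟩ : Set.range χ))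
    wlog hlt : b < c generalizing b c
    · exact this c b hbc.symm h.symm (by omega)
    have h1 : Ideal.Quotient.mk I (T (b : ℤ)) = Ideal.Quotient.mk I (T (c : ℤ)) := by
      have := congrArg Subtype.val h
      simpa [ψ] using this
    have h2 : Ideal.Quotient.mk I (T (-1 : ℤ)) = Ideal.Quotient.mk I (T ((c - b - 1 : ℕ) : ℤ)) := by
      have := congrArg (fun z => Ideal.Quotient.mk I (T (-1 - b : ℤ)) * z) h1
      simp only [← map_mul, ← T_add] at this
      convert this using 3 
      · ring
      · omega
    have hsurj : Set.range χ = Set.univ := by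
      refine Set.eq_univ_of_forall fun z => ?_
      obtain ⟨z, rfl⟩ := Ideal.Quotient.mk_surjective z
      obtain ⟨d, g, hg⟩ := exists_T_pow z
      have : Ideal.Quotient.mk I z = ψ (g * Polynomial.X ^ ((c - b - 1) * d)) := by
        have e : z = Polynomial.toLaurent g * (T (-1 : ℤ)) ^ d := by
          rw [hg, T_pow, mul_assoc, ← T_add]
          simp
        rw [e, map_mul, map_pow, h2, ← map_pow, ← map_mul]
        simp [ψ]
        ring_nf
      rw [this]
      exact hχ _
    rw [hsurj] at hfin
    exact Set.finite_univ_iff.1 hfin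

end LaurentPolynomial

/-! ### Modules over a PID with finite quotients -/

/-- Over a ring with finite quotients, a finitely generated torsion module is finite. -/
theorem Module.IsTorsion.finite_of_hasFiniteQuotients {R M : Type*} [CommRing R]
    [Nontrivial R] [Ring.HasFiniteQuotients R] [AddCommGroup M] [Module R M] [Module.Finite R M]
    (h : Module.IsTorsion R M) : Finite M := by
  obtain ⟨a, ha, ha0⟩ := Set.nonempty_def.1 (Submodule.annihilator_top_inter_nonZeroDivisors h)
  have hne : Module.annihilator R M ≠ ⊥ := by
    rintro hb
    rw [SetLike.mem_coe, Submodule.annihilator_top, hb, Ideal.mem_bot] at ha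
    exact zero_notMem_nonZeroDivisors (ha ▸ ha0)
  have : Finite (R ⧸ Module.annihilator R M) := Ring.HasFiniteQuotients.finiteQuotient hne
  let : Module (R ⧸ Module.annihilator R M) M := Module.quotientAnnihilator
  have : IsScalarTower R (R ⧸ Module.annihilator R M) M := inferInstance
  have : Module.Finite (R ⧸ Module.annihilator R M) M :=
    Module.Finite.of_restrictScalars_finite R _ M
  exact Module.finite_of_finite (R ⧸ Module.annihilator R M)

/-- Over an infinite domain, a finite module is torsion. -/
theorem Module.IsTorsion.of_finite (R M : Type*) [CommRing R] [IsDomain R] [Infinite R]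
    [AddCommGroup M] [Module R M] [Finite M] : Module.IsTorsion R M := by
  intro x
  obtain ⟨a, b, hab, h⟩ := Finite.exists_ne_map_eq_of_infinite (fun r : R => r • x)
  exact ⟨⟨a - b, mem_nonZeroDivisors_of_ne_zero (sub_ne_zero.2 hab)⟩, by
    rw [Submonoid.mk_smul, sub_smul, sub_eq_zero]; exact h⟩

/-- A finitely generated infinite module over a PID with finite quotients, all of whose proper
quotients are finite, is free of rank one. -/
theorem Module.nonempty_linearEquiv_self_of_finite_quotients {R M : Type*} [CommRing R] [IsDomain R]
    [IsPrincipalIdealRing R] [Infinite R] [Ring.HasFiniteQuotients R] [AddCommGroup M] [Module R M]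
    [Module.Finite R M] [Infinite M]
    (h : ∀ N : Submodule R M, N ≠ ⊥ → Finite (M ⧸ N)) : Nonempty (M ≃ₗ[R] R) := by
  -- If the torsion T is nonzero, then M/T is finite, hence torsion; so M is torsion, hence finite.
  have htf : Submodule.torsion R M = ⊥ := by
    by_contra hT
    have := h _ hT
    have h1 : Module.IsTorsion R M := by
      intro x
      obtain ⟨a, ha⟩ := @Module.IsTorsion.of_finite R (M ⧸ Submodule.torsion R M) _ _ _ _ _ _
        (Submodule.Quotient.mk x)
      rw [Submonoid.smul_def, ← Submodule.Quotient.mk_smul, Submodule.Quotient.mk_eq_zero] at ha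
      obtain ⟨b, hb⟩ := ha
      exact ⟨b * a, by rw [mul_smul]; exact hb⟩
    exact not_finite_iff_infinite.2 ‹_› h1.finite_of_hasFiniteQuotients
  have : Module.IsTorsionFree R M := Submodule.isTorsionFree_iff_torsion_eq_bot.2 htf
  have : Module.Free R M := Module.free_of_finite_type_torsion_free'
  obtain ⟨x, hx⟩ := exists_ne (0 : M)
  -- The quotient by Rx is finite, so of rank 0, and M has the rank of Rx, which is 1.
  have hN : R ∙ x ≠ ⊥ := by simpa using hx
  have := h _ hN
  have h0 : Module.rank R (M ⧸ (R ∙ x)) = 0 :=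
    Module.rank_eq_zero_iff_isTorsion.2 (Module.IsTorsion.of_finite R _)
  have h1 := rank_quotient_add_rank_of_isDomain (R ∙ x)
  have h2 : Module.rank R (R ∙ x) = 1 := by
    have := (LinearEquiv.toSpanNonzeroSingleton R M x hx).lift_rank_eq
    rw [rank_self, Cardinal.lift_one] at this
    exact Cardinal.lift_eq_one.1 this.symm
  rw [h0, h2, zero_add] at h1
  exact (nonempty_linearEquiv_of_finrank_eq_one
    (Module.finrank_eq_of_rank_eq (by rw [← h1]; simp))).map LinearEquiv.symm

/-! ### Computation in the lamplighter group and finite index in terms of triples -/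

namespace Lamplighter

open LaurentPolynomial

variable {p n : ℕ}

theorem elt_left_right (g : LGroup p n) : elt g.left.toAdd g.right.toAdd = g := rfl

@[simp] theorem right_elt (a : Base p n) (r : ℤ) : (elt a r).right.toAdd = r := rfl

@[simp] theorem left_elt (a : Base p n) (r : ℤ) : (elt a r).left.toAdd = a := rfl

theorem elt_mul_elt (a b : Base p n) (r t : ℤ) :
    elt a r * elt b t = elt (a + (T r : (ZMod p)[T;T⁻¹]) • b) (r + t) := rfl

theorem elt_zero_zero : elt (0 : Base p n) 0 = 1 := rfl

theorem elt_inv (a : Base p n) (r : ℤ) :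
    (elt a r)⁻¹ = elt (-((T (-r) : (ZMod p)[T;T⁻¹]) • a)) (-r) := by
  rw [inv_eq_iff_mul_eq_one, elt_mul_elt, smul_neg, smul_smul, ← T_add, add_neg_cancel, T_zero,
    one_smul, add_neg_cancel, elt_zero_zero]

theorem right_mul (g h : LGroup p n) : (g * h).right.toAdd = g.right.toAdd + h.right.toAdd := rfl

theorem right_inv (g : LGroup p n) : (g⁻¹).right.toAdd = -g.right.toAdd := rfl

theorem left_mul (g h : LGroup p n) : (g * h).left.toAdd =
    g.left.toAdd + (T g.right.toAdd : (ZMod p)[T;T⁻¹]) • h.left.toAdd := rfl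

theorem left_inv (g : LGroup p n) : (g⁻¹).left.toAdd =
    -((T (-g.right.toAdd) : (ZMod p)[T;T⁻¹]) • g.left.toAdd) := by
  rw [← elt_left_right g, elt_inv]; rfl

theorem right_zpow (g : LGroup p n) (k : ℤ) : (g ^ k).right.toAdd = k * g.right.toAdd := by
  have := map_zpow (SemidirectProduct.rightHom (φ := shift p n)) g k
  rw [SemidirectProduct.rightHom_eq_right] at this
  rw [this, toAdd_zpow, smul_eq_mul]

theorem expand_T (s : ℕ) (k : ℤ) : expand p s (T k) = T (s * k) := by
  have := expand_C_mul_T p s 1 k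
  rwa [map_one, one_mul, one_mul] at this

/-- An additive subgroup invariant under multiplication by `x^{±s}` is invariant under `𝔽_p[x^{±s}]`. -/
theorem expand_smul_mem {s : ℕ} {U : AddSubgroup (Base p n)}
    (hU : ∀ k : ℤ, ∀ a ∈ U, (T (s * k) : (ZMod p)[T;T⁻¹]) • a ∈ U) (f : (ZMod p)[T;T⁻¹])
    {a : Base p n} (ha : a ∈ U) : expand p s f • a ∈ U := by
  induction f using LaurentPolynomial.induction_on' with
  | add f g hf hg => rw [map_add, add_smul]; exact U.add_mem hf hg
  | C_mul_T k c =>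
    rw [expand_C_mul_T, mul_smul, LaurentPolynomial.C_eq_algebraMap, algebraMap_smul]
    exact ZMod.smul_mem (K := U) (hU k a ha) c

section Triple

variable {V : Subgroup (LGroup p n)} {s : ℕ} {V₀ : AddSubgroup (Base p n)} {v : Base p n}

theorem IsTriple.dvd_right (h : IsTriple V s V₀ v) {g : LGroup p n} (hg : g ∈ V) :
    (s : ℤ) ∣ g.right.toAdd := by
  have : g.right ∈ V.map SemidirectProduct.rightHom := ⟨g, hg, rfl⟩
  rw [h.map_proj] at this
  obtain ⟨k, hk⟩ := Subgroup.mem_zpowers_iff.1 this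
  refine ⟨k, ?_⟩
  rw [← hk, toAdd_zpow, toAdd_ofAdd, smul_eq_mul, mul_comm]

/-- Elements of the subgroup are products of an element of `V₀` and a power of `(v, s)`. -/
theorem IsTriple.exists_eq (h : IsTriple V s V₀ v) {g : LGroup p n} (hg : g ∈ V) :
    ∃ u ∈ V₀, ∃ q : ℤ, g = elt u 0 * elt v s ^ q := by
  obtain ⟨q, hq⟩ := h.dvd_right hg
  have h1 : (g * (elt v s ^ q)⁻¹).right.toAdd = 0 := by
    rw [right_mul, right_inv, right_zpow, hq, right_elt]; ring
  have h2 : elt (g * (elt v s ^ q)⁻¹).left.toAdd 0 = g * (elt v s ^ q)⁻¹ := by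
    rw [← h1, elt_left_right]
  refine ⟨(g * (elt v s ^ q)⁻¹).left.toAdd, ?_, q, by rw [h2, inv_mul_cancel_right]⟩
  rw [h.mem_base, h2]
  exact V.mul_mem hg (V.inv_mem (V.zpow_mem h.mem q))

theorem IsTriple.finiteIndex_base (h : IsTriple V s V₀ v) (hV : V.FiniteIndex) :
    V₀.FiniteIndex := by
  have h0 : V.comap SemidirectProduct.inl = V₀.toSubgroup := by
    ext a; exact (h.mem_base a.toAdd).symm
  have h1 : (V.comap (SemidirectProduct.inl (φ := shift p n))).index ≠ 0 := by
    rw [Subgroup.index_comap]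
    exact fun h0 => hV.index_ne_zero (Subgroup.index_eq_zero_of_relIndex_eq_zero h0)
  rw [h0, AddSubgroup.index_toSubgroup] at h1
  exact ⟨h1⟩

theorem IsTriple.pos_of_finiteIndex (h : IsTriple V s V₀ v) (hV : V.FiniteIndex) : 0 < s := by
  rcases Nat.eq_zero_or_pos s with rfl | hs
  · have h1 := ne_zero_of_dvd_ne_zero hV.index_ne_zero
      (Subgroup.index_map_dvd V (SemidirectProduct.rightHom_surjective (φ := shift p n)))
    rw [h.map_proj, Nat.cast_zero, ofAdd_zero, Subgroup.zpowers_one_eq_bot,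
      Subgroup.index_bot] at h1
    exact absurd (Nat.card_eq_zero_of_infinite (α := Multiplicative ℤ)) h1
  · exact hs

/-- The elements (0, r)(a, 0), with 0 ≤ r < s and a among representatives modulo V₀, meet every left
coset. -/
theorem IsTriple.finiteIndex (h : IsTriple V s V₀ v) (hs : 0 < s) (hV₀ : V₀.FiniteIndex) :
    V.FiniteIndex := by
  have : Finite (Base p n ⧸ V₀) := AddSubgroup.finiteIndex_iff_finite_quotient.1 hV₀
  rw [Subgroup.finiteIndex_iff_finite_quotient]
  let F : Fin s × (Base p n ⧸ V₀) → LGroup p n ⧸ V := fun z =>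
    QuotientGroup.mk (elt 0 (z.1 : ℕ) * elt z.2.out 0)
  refine Finite.of_surjective F fun g => ?_
  obtain ⟨g, rfl⟩ := QuotientGroup.mk_surjective g
  have hs' : (0 : ℤ) < s := by exact_mod_cast hs
  have hr0 := Int.emod_nonneg g.right.toAdd hs'.ne'
  have hr1 := Int.emod_lt_of_pos g.right.toAdd hs'
  set r := g.right.toAdd % s with hr
  set w := elt (0 : Base p n) (-r) * (g * (elt v s ^ (g.right.toAdd / s))⁻¹) with hw
  have hwr : w.right.toAdd = 0 := by
    rw [hw, right_mul, right_mul, right_inv, right_zpow, right_elt, right_elt, hr]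
    linarith [Int.ediv_mul_add_emod g.right.toAdd s]
  have hwe : elt w.left.toAdd 0 = w := by rw [← hwr, elt_left_right]
  refine ⟨(⟨r.toNat, by omega⟩, QuotientAddGroup.mk w.left.toAdd), ?_⟩
  rw [QuotientGroup.eq]
  obtain ⟨u, hu⟩ := QuotientAddGroup.mk_out_eq_add V₀ w.left.toAdd
  have h1 : elt (0 : Base p n) r * w = g * (elt v s ^ (g.right.toAdd / s))⁻¹ := by
    rw [hw, ← mul_assoc, elt_mul_elt, smul_zero, add_zero, add_neg_cancel, elt_zero_zero, one_mul]
  have h2 : g = elt (0 : Base p n) r * w * elt v s ^ (g.right.toAdd / s) := by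
    rw [h1, inv_mul_cancel_right]
  have h3 : (elt ((QuotientAddGroup.mk w.left.toAdd : Base p n ⧸ V₀).out) 0)⁻¹ * w ∈ V := by
    rw [hu, ← hwe, elt_inv, elt_mul_elt, neg_zero, left_elt, T_zero, one_smul, one_smul, add_zero,
      neg_add_rev, neg_add_cancel_right, ← h.mem_base]
    exact V₀.neg_mem u.2
  dsimp only
  rw [Int.toNat_of_nonneg hr0]
  generalize (elt ((QuotientAddGroup.mk w.left.toAdd : Base p n ⧸ V₀).out) 0) = y at h3 ⊢
  have h4 : (elt 0 r * y)⁻¹ * g = y⁻¹ * w * elt v s ^ (g.right.toAdd / s) := by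
    rw [mul_inv_rev, mul_assoc, mul_assoc, eq_inv_mul_iff_mul_eq.2 ((mul_assoc _ _ _).symm.trans h2.symm)]
  rw [h4]
  exact V.mul_mem h3 (V.zpow_mem h.mem _)

end Triple

end Lamplighter

/-! ### Characterization of weak maximality -/

namespace Lamplighter

open LaurentPolynomial

section WeaklyMaximal

variable {p n : ℕ} {V : Subgroup (LGroup p n)} {s : ℕ}
  {V₀ : AddSubgroup (Base p n)} {v : Base p n}

/-- An `R`-linear isomorphism `𝒜ₙˢ / V₀ ≃ R` gives a surjection `𝒜ₙ → R` with kernel `V₀`. -/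
theorem IsTriple.exists_surjective (h : IsTriple V s V₀ v)
    (e : (BaseTwist p n s ⧸ h.submodule) ≃ₗ[(ZMod p)[T;T⁻¹]] (ZMod p)[T;T⁻¹]) :
    ∃ φ : Base p n →+ (ZMod p)[T;T⁻¹], Function.Surjective φ ∧ φ.ker = V₀ ∧
      ∀ f a, φ (expand p s f • a) = f * φ a := by
  let ψ : BaseTwist p n s →ₗ[(ZMod p)[T;T⁻¹]] (ZMod p)[T;T⁻¹] := e.toLinearMap ∘ₗ h.submodule.mkQ
  refine ⟨ψ.toAddMonoidHom, e.surjective.comp h.submodule.mkQ_surjective, ?_,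
    fun f a => ψ.map_smul f a⟩
  ext a
  change e (Submodule.Quotient.mk (p := h.submodule) a) = 0 ↔ a ∈ V₀
  exact (map_eq_zero_iff e e.injective).trans (Submodule.Quotient.mk_eq_zero h.submodule)

theorem IsTriple.right_eq_zero (h : IsTriple V 0 V₀ v) {g : LGroup p n} (hg : g ∈ V) :
    g.right.toAdd = 0 := by
  simpa using h.dvd_right hg

theorem IsTriple.mem_iff_right_eq_zero (h : IsTriple V 0 ⊤ v) {g : LGroup p n} :
    g ∈ V ↔ g.right.toAdd = 0 := by
  refine ⟨h.right_eq_zero, fun hg => ?_⟩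
  rw [← elt_left_right g, hg, ← h.mem_base]
  trivial

variable [Fact p.Prime]

/-- The kernel of a surjection `𝒜ₙˢ → R` is not invariant under `xᵗ` for a proper divisor `t` of
`s`: otherwise `x` would be a proper power in `R`. -/
theorem eq_one_of_ker_invariant {t m : ℕ} {φ : Base p n →+ (ZMod p)[T;T⁻¹]}
    (hφ : Function.Surjective φ) (hlin : ∀ f a, φ (expand p (t * m) f • a) = f * φ a)
    (hinv : ∀ a ∈ φ.ker, (T t : (ZMod p)[T;T⁻¹]) • a ∈ φ.ker) : m = 1 := by
  obtain ⟨a₀, ha₀⟩ := hφ 1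
  have key : ∀ a, φ ((T t : (ZMod p)[T;T⁻¹]) • a) = φ ((T t : (ZMod p)[T;T⁻¹]) • a₀) * φ a := by
    intro a
    -- Since φ(a₀) = 1, this difference lies in the kernel; so xᵗ acts on R as multiplication by u =
    -- φ(xᵗ a₀).
    have h1 := hinv (a - expand p (t * m) (φ a) • a₀) (by
      rw [AddMonoidHom.mem_ker, map_sub, hlin, ha₀, mul_one, sub_self])
    rw [AddMonoidHom.mem_ker, smul_sub, map_sub, smul_comm, hlin, sub_eq_zero] at h1
    rw [h1, mul_comm]
  have hpow : ∀ k : ℕ, φ ((T (t * k : ℕ) : (ZMod p)[T;T⁻¹]) • a₀) =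
      φ ((T t : (ZMod p)[T;T⁻¹]) • a₀) ^ k := by
    intro k
    induction k with
    | zero => simp [ha₀]
    | succ k ih =>
      rw [pow_succ', ← ih, ← key, smul_smul, ← T_add, Nat.mul_succ, Nat.cast_add, add_comm]
  refine eq_one_of_pow_eq_T (u := φ ((T t : (ZMod p)[T;T⁻¹]) • a₀)) ?_
  rw [← hpow, ← mul_one (T 1), ← ha₀, ← hlin, expand_T, mul_one]

theorem IsTriple.isWeaklyMaximal (h : IsTriple V s V₀ v) (hs : 0 < s)
    {φ : Base p n →+ (ZMod p)[T;T⁻¹]} (hφ : Function.Surjective φ) (hker : φ.ker = V₀)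
    (hlin : ∀ f a, φ (expand p s f • a) = f * φ a) : IsWeaklyMaximal V := by
  constructor
  · intro hV
    apply (h.finiteIndex_base hV).index_ne_zero
    rw [← hker, AddSubgroup.index_ker, AddMonoidHom.range_eq_top.2 hφ]
    exact AddSubgroup.card_top.trans Nat.card_eq_zero_of_infinite
  · intro K hK
    obtain ⟨t, K₀, w, hw⟩ := exists_isTriple K
    obtain ⟨m, hm⟩ : t ∣ s := by
      have := hw.dvd_right (hK.le h.mem)
      rw [right_elt] at this
      exact_mod_cast this
    have ht : 0 < t := Nat.pos_of_mul_pos_right (hm ▸ hs)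
    have hle : V₀ ≤ K₀ := fun a ha => (hw.mem_base a).2 (hK.le ((h.mem_base a).1 ha))
    apply hw.finiteIndex ht
    by_cases heq : K₀ = V₀
    · exfalso
      subst hm
      have : m = 1 := eq_one_of_ker_invariant hφ hlin fun a ha => by
        rw [hker, ← heq] at ha ⊢
        simpa using hw.T_smul_mem 1 ha
      subst this
      rw [mul_one] at h
      refine hK.not_ge fun g hg => ?_
      obtain ⟨q, hq⟩ := hw.dvd_right hg
      have h1 : (g * (elt v t ^ q)⁻¹).right.toAdd = 0 := by
        rw [right_mul, right_inv, right_zpow, hq, right_elt]; ring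
      have h2 : elt (g * (elt v t ^ q)⁻¹).left.toAdd 0 = g * (elt v t ^ q)⁻¹ := by
        rw [← h1, elt_left_right]
      have h3 : g * (elt v t ^ q)⁻¹ ∈ V := by
        rw [← h2, ← h.mem_base, ← heq, hw.mem_base, h2]
        exact K.mul_mem hg (K.inv_mem (hK.le (V.zpow_mem h.mem q)))
      exact (Subgroup.mul_mem_cancel_right V (V.inv_mem (V.zpow_mem h.mem q))).1 h3
    -- The preimage under φ of the nonzero ideal (φ b) has finite index and lies in K₀.
    · obtain ⟨b, hb, hbV⟩ := SetLike.exists_of_lt (lt_of_le_of_ne hle (Ne.symm heq))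
      have hf : φ b ≠ 0 := fun h0 => hbV (hker ▸ h0)
      have : Finite ((ZMod p)[T;T⁻¹] ⧸ Ideal.span {φ b}) :=
        Ring.HasFiniteQuotients.finiteQuotient (by simpa using hf)
      have : (Ideal.span {φ b}).toAddSubgroup.FiniteIndex :=
        AddSubgroup.finiteIndex_iff_finite_quotient.2 this
      have h1 : ((Ideal.span {φ b}).toAddSubgroup.comap φ).FiniteIndex :=
        ⟨by rw [AddSubgroup.index_comap_of_surjective _ hφ]; exact this.index_ne_zero⟩
      refine AddSubgroup.finiteIndex_of_le (H := (Ideal.span {φ b}).toAddSubgroup.comap φ) ?_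
      intro a ha
      obtain ⟨c, hc⟩ := Ideal.mem_span_singleton.1 (show φ a ∈ Ideal.span {φ b} from ha)
      have h2 : a - expand p s c • b ∈ K₀ := hle (by
        rw [← hker, AddMonoidHom.mem_ker, map_sub, hlin, hc, mul_comm, sub_self])
      have h3 : expand p s c • b ∈ K₀ := expand_smul_mem (fun k a ha => by
        rw [hm, Nat.cast_mul, mul_assoc]; exact hw.T_smul_mem _ ha) c hb
      simpa using K₀.add_mem h2 h3

/-- The subgroup `U V`, for a subgroup `V` of `ℒₙ` and a `V`-invariant subgroup `U` of the base
group. -/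
def extend (V : Subgroup (LGroup p n)) (U : AddSubgroup (Base p n))
    (hU : ∀ g ∈ V, ∀ a ∈ U, (T g.right.toAdd : (ZMod p)[T;T⁻¹]) • a ∈ U) :
    Subgroup (LGroup p n) where
  carrier := {g | ∃ h ∈ V, h.right.toAdd = g.right.toAdd ∧ g.left.toAdd - h.left.toAdd ∈ U}
  one_mem' := ⟨1, V.one_mem, rfl, by rw [sub_self]; exact U.zero_mem⟩
  mul_mem' := by
    rintro a b ⟨g, hg, hga, ha⟩ ⟨h, hh, hhb, hb⟩
    refine ⟨g * h, V.mul_mem hg hh, by rw [right_mul, right_mul, hga, hhb], ?_⟩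
    rw [left_mul, left_mul, ← hga, add_sub_add_comm, ← smul_sub]
    exact U.add_mem ha (hU g hg _ hb)
  inv_mem' := by
    rintro a ⟨g, hg, hga, ha⟩
    refine ⟨g⁻¹, V.inv_mem hg, by rw [right_inv, right_inv, hga], ?_⟩
    rw [left_inv, left_inv, ← hga, ← neg_sub', ← smul_sub]
    exact U.neg_mem (hU g⁻¹ (V.inv_mem hg) _ ha)

/-- Enlarges V₀ while keeping s and v, so that submodules of 𝒜ₙˢ / V₀ can be tested by overgroups of
V. -/
theorem IsTriple.extend (h : IsTriple V s V₀ v) {U : AddSubgroup (Base p n)} (hle : V₀ ≤ U)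
    (hU : ∀ g ∈ V, ∀ a ∈ U, (T g.right.toAdd : (ZMod p)[T;T⁻¹]) • a ∈ U) :
    V ≤ extend V U hU ∧ IsTriple (extend V U hU) s U v := by
  have hV : V ≤ Lamplighter.extend V U hU :=
    fun g hg => ⟨g, hg, rfl, by rw [sub_self]; exact U.zero_mem⟩
  refine ⟨hV, ?_, fun a => ⟨fun ha => ⟨1, V.one_mem, rfl, ?_⟩, ?_⟩, hV h.mem⟩
  · rw [← h.map_proj]
    refine le_antisymm ?_ (Subgroup.map_mono hV)
    rintro _ ⟨g, ⟨k, hk, hkg, -⟩, rfl⟩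
    exact ⟨k, hk, hkg⟩
  · change a - 0 ∈ U
    rwa [sub_zero]
  · rintro ⟨g, hg, hg0, ha⟩
    have h1 : elt g.left.toAdd 0 = g := by
      rw [right_elt] at hg0
      rw [← hg0, elt_left_right]
    have h2 := hle ((h.mem_base g.left.toAdd).2 (h1 ▸ hg))
    simpa using U.add_mem ha h2

/-- Division of exponents by s shows that the xʳ in each coordinate, 0 ≤ r < s, generate. -/
instance baseTwist_finite [NeZero s] : Module.Finite (ZMod p)[T;T⁻¹] (BaseTwist p n s) := by
  let b : Fin n × Fin s → BaseTwist p n s := fun z =>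
    (Pi.single z.1 (T (z.2 : ℕ)) : Base p n)
  have key : ∀ (j : Fin n) (f : (ZMod p)[T;T⁻¹]),
      (show BaseTwist p n s from (Pi.single j f : Base p n)) ∈
        Submodule.span (ZMod p)[T;T⁻¹] (Set.range b) := by
    intro j f
    induction f using LaurentPolynomial.induction_on' with
    | add f g hf hg => rw [Pi.single_add]; exact Submodule.add_mem _ hf hg
    | C_mul_T k c =>
      have hs : (0 : ℤ) < s := by exact_mod_cast NeZero.pos s
      have h0 := Int.emod_nonneg k hs.ne'
      have h1 := Int.emod_lt_of_pos k hs
      have h2 : (show BaseTwist p n s from (Pi.single j (C c * T k) : Base p n)) =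
          (C c * T (k / s) : (ZMod p)[T;T⁻¹]) • b (j, ⟨(k % s).toNat, by omega⟩) := by
        rw [twist_smul_def, expand_C_mul_T]
        change (Pi.single j (C c * T k) : Base p n) =
          (C c * T (s * (k / s)) : (ZMod p)[T;T⁻¹]) •
            (Pi.single j (T ((k % s).toNat : ℕ)) : Base p n)
        rw [← Pi.single_smul, smul_eq_mul, mul_assoc, ← T_add, Int.toNat_of_nonneg h0,
          Int.mul_ediv_add_emod]
      rw [h2]
      exact Submodule.smul_mem _ _ (Submodule.subset_span ⟨_, rfl⟩)
  refine ⟨Submodule.fg_def.2 ⟨Set.range b, Set.finite_range b, eq_top_iff.2 fun a _ => ?_⟩⟩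
  have : a = ∑ j, (show BaseTwist p n s from (Pi.single j ((show Base p n from a) j) : Base p n)) :=
    (Finset.univ_sum_single (show Base p n from a)).symm
  rw [this]
  exact Submodule.sum_mem _ fun j _ => key j _

theorem IsTriple.nonempty_linearEquiv (h : IsTriple V s V₀ v) (hs : 0 < s)
    (hV : IsWeaklyMaximal V) :
    Nonempty ((BaseTwist p n s ⧸ h.submodule) ≃ₗ[(ZMod p)[T;T⁻¹]] (ZMod p)[T;T⁻¹]) := by
  have : NeZero s := ⟨hs.ne'⟩
  have : Infinite (BaseTwist p n s ⧸ h.submodule) := by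
    by_contra hfin
    rw [not_infinite_iff_finite] at hfin
    exact hV.1 (h.finiteIndex hs (AddSubgroup.finiteIndex_iff_finite_quotient.2 hfin))
  refine Module.nonempty_linearEquiv_self_of_finite_quotients fun N hN => ?_
  let W : Submodule (ZMod p)[T;T⁻¹] (BaseTwist p n s) := N.comap h.submodule.mkQ
  let U : AddSubgroup (Base p n) := W.toAddSubgroup
  have hle : V₀ ≤ U := fun a ha => by
    change Submodule.Quotient.mk (p := h.submodule) a ∈ N
    rw [(Submodule.Quotient.mk_eq_zero h.submodule).2 ha]
    exact N.zero_mem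
  have hU : ∀ g ∈ V, ∀ a ∈ U, (T g.right.toAdd : (ZMod p)[T;T⁻¹]) • a ∈ U := by
    intro g hg a ha
    obtain ⟨q, hq⟩ := h.dvd_right hg
    rw [hq, ← expand_T]
    exact W.smul_mem (T q) ha
  obtain ⟨hVK, hK⟩ := h.extend hle hU
  have hlt : V < Lamplighter.extend V U hU := by
    refine lt_of_le_of_ne hVK fun heq => ?_
    obtain ⟨y, hy, hy0⟩ := Submodule.exists_mem_ne_zero_of_ne_bot hN
    obtain ⟨a, rfl⟩ := h.submodule.mkQ_surjective y
    have h1 : (show Base p n from a) ∈ V₀ := (h.mem_base _).2 (heq ▸ (hK.mem_base a).1 hy)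
    exact hy0 ((Submodule.Quotient.mk_eq_zero h.submodule).2 h1)
  have h2 := hK.finiteIndex_base (hV.2 _ hlt)
  have h3 : Finite (BaseTwist p n s ⧸ W) := AddSubgroup.finiteIndex_iff_finite_quotient.1 h2
  exact Finite.of_surjective (W.mapQ N h.submodule.mkQ le_rfl) (by
    intro z
    obtain ⟨y, rfl⟩ := N.mkQ_surjective z
    obtain ⟨a, rfl⟩ := h.submodule.mkQ_surjective y
    exact ⟨W.mkQ a, rfl⟩)

/-- Adjoining the whole base group leaves s = 0, so the index stays infinite; any overgroup of the
base group with s = 0 is the base group. -/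
theorem IsTriple.isWeaklyMaximal_iff_zero (h : IsTriple V 0 V₀ v) :
    IsWeaklyMaximal V ↔ V₀ = ⊤ := by
  constructor
  · intro hV
    by_contra hne
    obtain ⟨hVK, hK⟩ := h.extend (U := ⊤) le_top fun _ _ _ _ => trivial
    have := hK.pos_of_finiteIndex (hV.2 _ (lt_of_le_of_ne hVK fun heq => hne ?_))
    · exact this.ne rfl
    · ext a
      rw [h.mem_base, heq, ← hK.mem_base]
  · rintro rfl
    refine ⟨fun hV => (h.pos_of_finiteIndex hV).ne rfl, fun K hK => ?_⟩
    obtain ⟨t, K₀, w, hw⟩ := exists_isTriple K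
    have hK₀ : K₀ = ⊤ := eq_top_iff.2 fun a ha => (hw.mem_base a).2 (hK.le ((h.mem_base a).1 ha))
    subst hK₀
    refine hw.finiteIndex (Nat.pos_of_ne_zero ?_) inferInstance
    rintro rfl
    exact hK.not_ge fun g hg => h.mem_iff_right_eq_zero.2 (hw.right_eq_zero hg)

theorem IsTriple.isWeaklyMaximal_iff (h : IsTriple V s V₀ v) :
    IsWeaklyMaximal V ↔ (s = 0 ∧ V₀ = ⊤) ∨ (0 < s ∧
      Nonempty ((BaseTwist p n s ⧸ h.submodule) ≃ₗ[(ZMod p)[T;T⁻¹]] (ZMod p)[T;T⁻¹])) := by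
  rcases Nat.eq_zero_or_pos s with rfl | hs
  · simp [h.isWeaklyMaximal_iff_zero]
  · simp only [hs.ne', false_and, false_or, hs, true_and]
    refine ⟨h.nonempty_linearEquiv hs, fun ⟨e⟩ => ?_⟩
    obtain ⟨φ, hφ, hker, hlin⟩ := h.exists_surjective e
    exact h.isWeaklyMaximal hs hφ hker hlin

end WeaklyMaximal

end Lamplighter

/-! ### The pro-p topology of a group -/

section ProP

variable {p : ℕ} [Fact p.Prime] {G : Type*} [Group G]

/-- The index of M ∩ N divides the product of the indices of M and N, so one N can replace the
finitely many coordinates of a basic open set. -/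
theorem PIndexNormal.exists_forall_le (I : Finset (PIndexNormal p G)) :
    ∃ N : PIndexNormal p G, ∀ M ∈ I, N.1 ≤ M.1 := by
  classical
  induction I using Finset.induction_on with
  | empty => exact ⟨⟨⊤, inferInstance, 0, by simp⟩, by simp⟩
  | insert M I _ ih =>
    obtain ⟨N, hN⟩ := ih
    obtain ⟨a, ha⟩ := M.2.2
    obtain ⟨b, hb⟩ := N.2.2
    have := M.2.1
    have := N.2.1
    obtain ⟨c, -, hc⟩ : ∃ c ≤ a + b, (M.1 ⊓ N.1).index = p ^ c := by
      rw [← Nat.dvd_prime_pow Fact.out, ← Subgroup.relIndex_mul_index inf_le_right,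
        Subgroup.inf_relIndex_right, pow_add, ← ha, ← hb]
      exact mul_dvd_mul_right (Subgroup.relIndex_dvd_index_of_normal _ _) _
    refine ⟨⟨M.1 ⊓ N.1, inferInstance, c, hc⟩, fun K hK => ?_⟩
    rcases Finset.mem_insert.1 hK with rfl | hK
    · exact inf_le_left
    · exact inf_le_right.trans (hN K hK)

/-- A subset is closed in the pro-`p` topology if and only if it contains every element whose image
lies in the image of the subset in every quotient by a normal subgroup of `p`-power index. -/
theorem isClosed_proPTopology_iff {S : Set G} :
    IsClosed[proPTopology p G] S ↔
      ∀ g, (∀ N : PIndexNormal p G, ∃ h ∈ S, g⁻¹ * h ∈ N.1) → g ∈ S := by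
  rw [← @isOpen_compl_iff _ _ (proPTopology p G)]
  constructor
  · intro hS g hg
    by_contra hgS
    obtain ⟨A, hA, hAS⟩ := isOpen_induced_iff.1 hS
    obtain ⟨B, hB, rfl⟩ := (@isOpen_induced_iff _ _ (@Pi.topologicalSpace _ _ fun _ => ⊥) _ _).1 hA
    have hgB : (toProPCompletion p G g).1 ∈ B := by
      have : g ∈ Sᶜ := hgS
      rwa [← hAS] at this
    obtain ⟨I, u, hu, hI⟩ := (@isOpen_pi_iff _ _ (fun _ => ⊥) _).1 hB _ hgB
    obtain ⟨N, hN⟩ := PIndexNormal.exists_forall_le I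
    obtain ⟨h, hh, hgh⟩ := hg N
    have : h ∈ Sᶜ := by
      rw [← hAS]
      refine hI fun M hM => ?_
      have h1 : (QuotientGroup.mk h : G ⧸ M.1) = QuotientGroup.mk g :=
        (QuotientGroup.eq.2 (hN M hM hgh)).symm
      change (QuotientGroup.mk h : G ⧸ M.1) ∈ u M
      rw [h1]
      exact (hu M hM).2
    exact this hh
  · intro hS
    rw [@isOpen_iff_forall_mem_open _ (proPTopology p G)]
    intro g hg
    have h1 : ∃ N : PIndexNormal p G, ∀ h ∈ S, g⁻¹ * h ∉ N.1 := by
      by_contra! hcon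
      exact hg (hS g hcon)
    obtain ⟨N, hN⟩ := h1
    refine ⟨{x | (QuotientGroup.mk x : G ⧸ N.1) = QuotientGroup.mk g}, fun x hx hxS => ?_, ?_, rfl⟩
    · exact hN x hxS (QuotientGroup.eq.1 (Eq.symm hx))
    · let _ : ∀ M : PIndexNormal p G, TopologicalSpace (G ⧸ M.1) := fun _ => ⊥
      refine isOpen_induced_iff.2 ⟨{f | f.1 N = QuotientGroup.mk g},
        isOpen_induced_iff.2 ⟨{f | f N = QuotientGroup.mk g}, ?_, rfl⟩, rfl⟩
      have hc : Continuous fun f : (M : PIndexNormal p G) → G ⧸ M.1 => f N := continuous_apply N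
      exact hc.isOpen_preimage {QuotientGroup.mk g} trivial

end ProP

/-! ### Congruence subgroups and closedness -/

namespace Lamplighter

open LaurentPolynomial

variable {p n : ℕ} [Fact p.Prime]

instance : CharP (ZMod p)[T;T⁻¹] p :=
  charP_of_injective_algebraMap (algebraMap (ZMod p) (ZMod p)[T;T⁻¹]).injective p

theorem T_sub_one_ne_zero {t : ℤ} (ht : t ≠ 0) : (T t - 1 : (ZMod p)[T;T⁻¹]) ≠ 0 := by
  intro h
  have := congrArg degree (sub_eq_zero.1 h)
  rw [← T_zero, degree_T, degree_T] at this
  exact ht (by exact_mod_cast this)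

theorem T_sub_one_dvd {a b : ℤ} (h : a ∣ b) : (T a - 1 : (ZMod p)[T;T⁻¹]) ∣ T b - 1 := by
  obtain ⟨q, rfl⟩ := h
  have key : ∀ m : ℕ, (T a - 1 : (ZMod p)[T;T⁻¹]) ∣ T (a * m) - 1 := fun m => by
    have := sub_one_dvd_pow_sub_one (T a : (ZMod p)[T;T⁻¹]) m
    rwa [T_pow, mul_comm] at this
  rcases Int.eq_nat_or_neg q with ⟨m, rfl | rfl⟩
  · exact key m
  · have : (T (a * -(m : ℤ)) - 1 : (ZMod p)[T;T⁻¹]) = -T (a * -(m : ℤ)) * (T (a * m) - 1) := by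
      rw [mul_sub, neg_mul, ← T_add, mul_neg, neg_add_cancel, T_zero]
      ring
    rw [this]
    exact (key m).mul_left _

theorem T_sub_one_pow_char_pow (t : ℤ) (i : ℕ) :
    (T t - 1 : (ZMod p)[T;T⁻¹]) ^ p ^ i = T ((p : ℤ) ^ i * t) - 1 := by
  rw [sub_pow_char_pow, one_pow, T_pow, Nat.cast_pow]

/-- The submodule `f 𝒜ₙ` of the base group. -/
def multiples (n : ℕ) (f : (ZMod p)[T;T⁻¹]) : Submodule (ZMod p)[T;T⁻¹] (Base p n) :=
  LinearMap.range (LinearMap.lsmul (ZMod p)[T;T⁻¹] (Base p n) f)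

theorem smul_mem_multiples {f g : (ZMod p)[T;T⁻¹]} (h : f ∣ g) (a : Base p n) :
    g • a ∈ multiples n f := by
  obtain ⟨c, rfl⟩ := h
  exact ⟨c • a, by rw [LinearMap.lsmul_apply, smul_smul]⟩

theorem finiteIndex_multiples {f : (ZMod p)[T;T⁻¹]} (hf : f ≠ 0) :
    (multiples n f).toAddSubgroup.FiniteIndex := by
  have : Module.IsTorsion (ZMod p)[T;T⁻¹] (Base p n ⧸ multiples n f) := by
    intro x
    obtain ⟨a, rfl⟩ := (multiples n f).mkQ_surjective x
    refine ⟨⟨f, mem_nonZeroDivisors_of_ne_zero hf⟩, ?_⟩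
    exact (Submodule.Quotient.mk_eq_zero _).2 (smul_mem_multiples dvd_rfl a)
  exact AddSubgroup.finiteIndex_iff_finite_quotient.2 this.finite_of_hasFiniteQuotients

/-- The subgroup `(x^{pᵏ} - 1)ᵉ 𝒜ₙ ⋊ p^{k+i} ℤ` of `ℒₙ`. -/
def congruenceSubgroup (p n k i e : ℕ) [Fact p.Prime] : Subgroup (LGroup p n) where
  carrier := {g | g.left.toAdd ∈ multiples n ((T ((p : ℤ) ^ k) - 1 : (ZMod p)[T;T⁻¹]) ^ e) ∧
    (p : ℤ) ^ (k + i) ∣ g.right.toAdd}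
  one_mem' := ⟨Submodule.zero_mem _, dvd_zero _⟩
  mul_mem' := fun ⟨ha, ha'⟩ ⟨hb, hb'⟩ =>
    ⟨Submodule.add_mem _ ha (Submodule.smul_mem _ _ hb), dvd_add ha' hb'⟩
  inv_mem' := fun {g} ⟨ha, ha'⟩ => by
    refine ⟨?_, ?_⟩
    · rw [left_inv]
      exact Submodule.neg_mem _ (Submodule.smul_mem _ _ ha)
    · rw [right_inv]
      exact (dvd_neg).2 ha'

variable {k i e : ℕ}

theorem pow_dvd_T_sub_one (he : e ≤ p ^ i) {t : ℤ} (ht : (p : ℤ) ^ (k + i) ∣ t) :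
    (T ((p : ℤ) ^ k) - 1 : (ZMod p)[T;T⁻¹]) ^ e ∣ T t - 1 := by
  refine (pow_dvd_pow _ he).trans ?_
  rw [T_sub_one_pow_char_pow, ← pow_add, add_comm]
  exact T_sub_one_dvd ht

/-- Conjugating (b, t) by (a, r) gives base part xʳb - (xᵗ - 1)a; the bound on e makes (x^{pᵏ} - 1)ᵉ
divide xᵗ - 1. -/
theorem normal_congruenceSubgroup (he : e ≤ p ^ i) : (congruenceSubgroup p n k i e).Normal := by
  refine ⟨fun h ⟨h1, h2⟩ g => ⟨?_, ?_⟩⟩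
  · have : (g * h * g⁻¹).left.toAdd = (T g.right.toAdd : (ZMod p)[T;T⁻¹]) • h.left.toAdd -
        (T h.right.toAdd - 1 : (ZMod p)[T;T⁻¹]) • g.left.toAdd := by
      rw [left_mul, left_mul, left_inv, right_mul, smul_neg, smul_smul, ← T_add, sub_smul, one_smul,
        add_neg_cancel_comm]
      abel
    rw [this]
    exact Submodule.sub_mem _ (Submodule.smul_mem _ _ h1)
      (smul_mem_multiples (pow_dvd_T_sub_one he h2) _)
  · rw [right_mul, right_mul, right_inv, add_right_comm, add_neg_cancel, zero_add]
    exact h2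

theorem isTriple_congruenceSubgroup : IsTriple (congruenceSubgroup p n k i e) (p ^ (k + i))
    (multiples n ((T ((p : ℤ) ^ k) - 1 : (ZMod p)[T;T⁻¹]) ^ e)).toAddSubgroup 0 := by
  have hmem : elt 0 ((p ^ (k + i) : ℕ) : ℤ) ∈ congruenceSubgroup p n k i e :=
    ⟨Submodule.zero_mem _, by rw [right_elt, Nat.cast_pow]⟩
  refine ⟨le_antisymm ?_ ?_, fun a => ⟨fun ha => ⟨ha, dvd_zero _⟩, fun ha => ha.1⟩, hmem⟩
  · rintro _ ⟨g, ⟨-, q, hq⟩, rfl⟩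
    refine Subgroup.mem_zpowers_iff.2 ⟨q, ?_⟩
    apply Multiplicative.toAdd.injective
    rw [toAdd_zpow, toAdd_ofAdd, smul_eq_mul, SemidirectProduct.rightHom_eq_right, hq, mul_comm,
      Nat.cast_pow]
  · rw [Subgroup.zpowers_le]
    exact ⟨_, hmem, rfl⟩

/-- The quotient is a finite p-group: a p^{k+i}-th power is represented by a base element, and the
base group has exponent p. -/
theorem exists_index_congruenceSubgroup (he : e ≤ p ^ i) :
    ∃ j, (congruenceSubgroup p n k i e).index = p ^ j := by
  have := normal_congruenceSubgroup (n := n) (k := k) he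
  have hp : 0 < p := (Fact.out : p.Prime).pos
  have : (congruenceSubgroup p n k i e).FiniteIndex :=
    isTriple_congruenceSubgroup.finiteIndex (pow_pos hp _)
      (finiteIndex_multiples (pow_ne_zero _ (T_sub_one_ne_zero (by positivity))))
  refine (IsPGroup.iff_card (G := LGroup p n ⧸ congruenceSubgroup p n k i e)).1 fun x => ?_
  obtain ⟨g, rfl⟩ := QuotientGroup.mk_surjective x
  refine ⟨k + i + 1, ?_⟩
  have h1 : g ^ p ^ (k + i) =
      elt (g ^ p ^ (k + i)).left.toAdd 0 * elt 0 (p ^ (k + i) * g.right.toAdd) := by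
    rw [elt_mul_elt, smul_zero, add_zero, zero_add]
    have := right_zpow g ((p ^ (k + i) : ℕ) : ℤ)
    rw [zpow_natCast, Nat.cast_pow] at this
    rw [← this, elt_left_right]
  rw [pow_succ, pow_mul, ← QuotientGroup.mk_pow, h1, QuotientGroup.mk_mul_of_mem,
    ← QuotientGroup.mk_pow]
  · change (((SemidirectProduct.inl (Multiplicative.ofAdd (g ^ p ^ (k + i)).left.toAdd) :
      LGroup p n) ^ p : LGroup p n) : LGroup p n ⧸ congruenceSubgroup p n k i e) = 1
    rw [← map_pow, ← ofAdd_nsmul, ZModModule.char_nsmul_eq_zero p, ofAdd_zero, map_one]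
    rfl
  · exact ⟨Submodule.zero_mem _, Dvd.intro _ rfl⟩

theorem elt_pow (v : Base p n) (s : ℤ) (m : ℕ) :
    elt v s ^ m = elt ((∑ j ∈ Finset.range m, (T s : (ZMod p)[T;T⁻¹]) ^ j) • v) (m * s) := by
  induction m with
  | zero => simp [elt_zero_zero]
  | succ m ih =>
    rw [pow_succ, ih, elt_mul_elt, Finset.sum_range_succ, add_smul, T_pow]
    push_cast
    ring_nf

/-- By Frobenius the geometric sum is (xˢ - 1)^{pⁱ} / (xˢ - 1). -/
theorem elt_pow_char_pow (v : Base p n) {s : ℤ} (hs : s ≠ 0) (i : ℕ) :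
    elt v s ^ p ^ i = elt ((T s - 1 : (ZMod p)[T;T⁻¹]) ^ (p ^ i - 1) • v) ((p : ℤ) ^ i * s) := by
  have hp : 0 < p ^ i := pow_pos (Fact.out : p.Prime).pos _
  rw [elt_pow, Nat.cast_pow]
  congr 2
  apply mul_left_cancel₀ (T_sub_one_ne_zero (p := p) hs)
  rw [mul_geom_sum, ← pow_succ', Nat.sub_add_cancel hp, sub_pow_char_pow, one_pow]

variable {V : Subgroup (LGroup p n)} {s : ℕ} {V₀ : AddSubgroup (Base p n)} {v : Base p n}

theorem IsTriple.isClosed_of_zero (h : IsTriple V 0 ⊤ v) :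
    IsClosed[proPTopology p (LGroup p n)] (V : Set (LGroup p n)) := by
  rw [isClosed_proPTopology_iff]
  intro g hg
  rw [SetLike.mem_coe, h.mem_iff_right_eq_zero]
  -- With r the ℤ-part of g, p^{|r|} divides r; as p^{|r|} > |r|, r is zero.
  obtain ⟨a, ha, hga, hdvd⟩ := hg ⟨congruenceSubgroup p n g.right.toAdd.natAbs 0 0,
    normal_congruenceSubgroup (Nat.zero_le _), exists_index_congruenceSubgroup (Nat.zero_le _)⟩
  rw [right_mul, right_inv, h.right_eq_zero ha, add_zero, add_zero, dvd_neg] at hdvd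
  refine Int.eq_zero_of_abs_lt_dvd hdvd ?_
  rw [Int.abs_eq_natAbs]
  exact_mod_cast Nat.lt_pow_self (Fact.out : p.Prime).one_lt

theorem IsTriple.isClosed_of_pow (h : IsTriple V (p ^ k) V₀ v)
    {φ : Base p n →+ (ZMod p)[T;T⁻¹]} (hker : φ.ker = V₀)
    (hlin : ∀ f a, φ (expand p (p ^ k) f • a) = f * φ a) :
    IsClosed[proPTopology p (LGroup p n)] (V : Set (LGroup p n)) := by
  have hp : 0 < p := (Fact.out : p.Prime).pos
  have hs : ((p ^ k : ℕ) : ℤ) ≠ 0 := by positivity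
  rw [isClosed_proPTopology_iff]
  intro g hg
  obtain ⟨q, hq⟩ : ((p ^ k : ℕ) : ℤ) ∣ g.right.toAdd := by
    obtain ⟨a, ha, -, hdvd⟩ := hg ⟨congruenceSubgroup p n k 0 0,
      normal_congruenceSubgroup (Nat.zero_le _), exists_index_congruenceSubgroup (Nat.zero_le _)⟩
    rw [right_mul, right_inv, add_zero, ← Nat.cast_pow] at hdvd
    exact dvd_neg.1 ((dvd_add_left (h.dvd_right ha)).1 hdvd)
  set z := (elt v ((p ^ k : ℕ) : ℤ) ^ q)⁻¹ with hz
  have hzV : z ∈ V := V.inv_mem (V.zpow_mem h.mem q)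
  have hgz : (g * z).right.toAdd = 0 := by
    rw [hz, right_mul, right_inv, right_zpow, hq, right_elt]; ring
  have hgz' : elt (g * z).left.toAdd 0 = g * z := by rw [← hgz, elt_left_right]
  set a := (g * z).left.toAdd
  -- The exponent pⁱ - 1 is the one for which (v, s)^{pⁱ} lies in the congruence subgroup. Hence a
  -- agrees with an element of V₀ modulo (x^{pᵏ} - 1)^{pⁱ-1} 𝒜ₙ, which φ sends into (x - 1)^{pⁱ-1}
  -- R.
  have key : ∀ i, φ a ∈ Ideal.span {(T 1 - 1 : (ZMod p)[T;T⁻¹])} ^ (p ^ i - 1) := by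
    intro i
    have hN := normal_congruenceSubgroup (n := n) (k := k) (Nat.sub_le (p ^ i) 1)
    obtain ⟨b, hb, hgb⟩ := hg ⟨congruenceSubgroup p n k i (p ^ i - 1), hN,
      exists_index_congruenceSubgroup (Nat.sub_le _ _)⟩
    have h1 : (elt a 0)⁻¹ * (b * z) ∈ congruenceSubgroup p n k i (p ^ i - 1) := by
      have := hN.conj_mem _ hgb z⁻¹
      rw [hgz']
      convert this using 1
      group
    obtain ⟨u, hu, r, hr⟩ := h.exists_eq (V.mul_mem hb hzV)
    rw [hr] at h1
    have h2 := h1.2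
    rw [right_mul, right_mul, right_inv, right_elt, right_elt, right_zpow, right_elt, neg_zero,
      zero_add, zero_add, Nat.cast_pow, pow_add, mul_comm r,
      mul_dvd_mul_iff_left (by positivity)] at h2
    obtain ⟨m, rfl⟩ := h2
    have h3 : elt v ((p ^ k : ℕ) : ℤ) ^ ((p : ℤ) ^ i * m) ∈
        congruenceSubgroup p n k i (p ^ i - 1) := by
      rw [zpow_mul]
      refine Subgroup.zpow_mem _ ?_ _
      rw [← Nat.cast_pow, zpow_natCast, elt_pow_char_pow v hs]
      refine ⟨?_, ?_⟩
      · rw [left_elt, Nat.cast_pow]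
        exact smul_mem_multiples dvd_rfl v
      · rw [right_elt, Nat.cast_pow, ← pow_add, add_comm]
    rw [← mul_assoc, Subgroup.mul_mem_cancel_right _ h3, elt_inv, elt_mul_elt] at h1
    obtain ⟨w, hw⟩ := h1.1
    rw [left_elt, neg_zero, T_zero, one_smul, one_smul, LinearMap.lsmul_apply] at hw
    have h4 := congrArg φ hw
    rw [map_add, map_neg, show φ u = 0 from AddMonoidHom.mem_ker.1 (hker.symm ▸ hu), add_zero] at h4
    have h5 : (T ((p : ℤ) ^ k) - 1 : (ZMod p)[T;T⁻¹]) ^ (p ^ i - 1) =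
        expand p (p ^ k) ((T 1 - 1) ^ (p ^ i - 1)) := by
      rw [map_pow, map_sub, map_one, expand_T, mul_one, Nat.cast_pow]
    rw [h5, hlin] at h4
    rw [Ideal.span_singleton_pow, ← neg_mem_iff, ← h4]
    exact Ideal.mul_mem_right _ _ (Ideal.mem_span_singleton_self _)
  have hne : Ideal.span {(T 1 - 1 : (ZMod p)[T;T⁻¹])} ≠ ⊤ := by
    rw [Ne, Ideal.span_singleton_eq_top]
    intro hu
    have := hu.map (eval₂ (RingHom.id (ZMod p)) 1)
    simp at this
  have h0 : φ a = 0 := by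
    -- Krull's intersection theorem; x - 1 is not a unit because it vanishes at 1.
    rw [← Ideal.mem_bot, ← Ideal.iInf_pow_eq_bot_of_isDomain _ hne, Ideal.mem_iInf]
    intro m
    refine Ideal.pow_le_pow_right ?_ (key m)
    have := Nat.lt_pow_self (n := m) (Fact.out : p.Prime).one_lt
    omega
  have h1 : a ∈ V₀ := hker ▸ h0
  rw [h.mem_base, hgz'] at h1
  exact (Subgroup.mul_mem_cancel_right V hzV).1 h1

/-- If a subgroup of `ℒₙ` is closed in the pro-`p` topology, then its intersection with the base
group is invariant under `x^{pᵏ}`, where `pᵏ` is the `p`-part of the index of its projection. -/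
theorem IsTriple.T_smul_mem_of_isClosed {m : ℕ} (h : IsTriple V (p ^ k * m) V₀ v)
    (hm : ¬ p ∣ m) (hV : IsClosed[proPTopology p (LGroup p n)] (V : Set (LGroup p n)))
    {a : Base p n} (ha : a ∈ V₀) : (T ((p : ℤ) ^ k) : (ZMod p)[T;T⁻¹]) • a ∈ V₀ := by
  rw [h.mem_base]
  refine isClosed_proPTopology_iff.1 hV _ fun N => ?_
  have := N.2.1
  obtain ⟨j, hj⟩ := N.2.2
  -- From cm + dpʲ = 1, x^{pᵏ}a is the conjugate of x^{sc}a ∈ V₀ by (0, pʲdpᵏ), which lies in N as N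
  -- has index pʲ.
  obtain ⟨c, d, hcd⟩ : IsCoprime (m : ℤ) ((p : ℤ) ^ j) := by
    rw [← Nat.cast_pow, Nat.isCoprime_iff_coprime]
    exact (((Fact.out : p.Prime).coprime_iff_not_dvd.2 hm).symm).pow_right j
  have hb := h.T_smul_mem c ha
  set b := (T (((p ^ k * m : ℕ) : ℤ) * c) : (ZMod p)[T;T⁻¹]) • a with hb_def
  set z := elt (0 : Base p n) ((p : ℤ) ^ j * (d * (p : ℤ) ^ k)) with hz
  have hzN : z ∈ N.1 := by
    have h1 : (SemidirectProduct.inr (Multiplicative.ofAdd (1 : ℤ)) : LGroup p n) ^ p ^ j ∈ N.1 :=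
      hj ▸ N.1.pow_index_mem _
    have h2 := N.1.zpow_mem h1 (d * (p : ℤ) ^ k)
    rw [← map_pow, ← map_zpow, ← ofAdd_nsmul, ← ofAdd_zsmul] at h2
    convert h2 using 1
    change SemidirectProduct.inr _ = _
    congr 2
    simp [mul_comm]
  refine ⟨elt b 0, (h.mem_base b).1 hb, ?_⟩
  have h1 : elt ((T ((p : ℤ) ^ k) : (ZMod p)[T;T⁻¹]) • a) 0 = z * elt b 0 * z⁻¹ := by
    rw [hz, elt_inv, elt_mul_elt, elt_mul_elt, hb_def, smul_smul, ← T_add, smul_zero, neg_zero,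
      smul_zero, add_zero, zero_add, add_zero, add_neg_cancel]
    congr 3
    push_cast
    linear_combination (p : ℤ) ^ k * hcd.symm
  rw [h1]
  have h2 : (z * elt b 0 * z⁻¹)⁻¹ * elt b 0 = z * ((elt b 0)⁻¹ * z⁻¹ * (elt b 0)⁻¹⁻¹) := by group
  rw [h2]
  exact N.1.mul_mem hzN (N.2.1.conj_mem _ (N.1.inv_mem hzN) _)

theorem IsTriple.isClosed_iff (h : IsTriple V s V₀ v) (hV : IsWeaklyMaximal V) :
    IsClosed[proPTopology p (LGroup p n)] (V : Set (LGroup p n)) ↔ s = 0 ∨ ∃ k : ℕ, s = p ^ k := by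
  rcases h.isWeaklyMaximal_iff.1 hV with ⟨rfl, rfl⟩ | ⟨hs, ⟨f⟩⟩
  · simpa using h.isClosed_of_zero
  obtain ⟨φ, hφ, hker, hlin⟩ := h.exists_surjective f
  constructor
  · intro hcl
    obtain ⟨k, m, hm, rfl⟩ := Nat.exists_eq_pow_mul_and_not_dvd hs.ne' p
      (Fact.out : p.Prime).ne_one
    refine Or.inr ⟨k, ?_⟩
    rw [eq_one_of_ker_invariant hφ hlin fun a ha => ?_, mul_one]
    rw [hker] at ha ⊢
    rw [Nat.cast_pow]
    exact h.T_smul_mem_of_isClosed hm hcl ha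
  · rintro (rfl | ⟨k, rfl⟩)
    · exact absurd rfl hs.ne'
    · exact h.isClosed_of_pow hker hlin

end Lamplighter

end

theorem theorem3p9 (p : ℕ) [Fact p.Prime] (n : ℕ) (V : Subgroup (Lamplighter.LGroup p n))
    (s : ℕ) (V₀ : AddSubgroup (Lamplighter.Base p n)) (v : Lamplighter.Base p n)
    (h : Lamplighter.IsTriple V s V₀ v) :
    (IsWeaklyMaximal V ↔
      (s = 0 ∧ V₀ = ⊤) ∨
      (0 < s ∧ Nonempty
        ((Lamplighter.BaseTwist p n s ⧸ h.submodule) ≃ₗ[LaurentPolynomial (ZMod p)]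
          LaurentPolynomial (ZMod p)))) ∧
    (IsWeaklyMaximal V →
      (IsClosed[proPTopology p (Lamplighter.LGroup p n)] (V : Set (Lamplighter.LGroup p n)) ↔
        s = 0 ∨ ∃ k : ℕ, s = p ^ k)) :=
  ⟨h.isWeaklyMaximal_iff, h.isClosed_iff⟩
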